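/- Conventions. A forcing notion is a preordered set $(\mathbb P,\le)$ in which the greater condition is the stronger one. Conditions $p,q$ are compatible if there is $r$ with $p\le r$ and $q\le r$; an antichain is a set of pairwise incompatible conditions, and it is maximal if every condition is compatible with one of its members. $\mathbb P$ is ccc if all its antichains are countable, and atomless if every condition $p$ has two incompatible extensions $q,r\ge p$. A filter is a nonempty set $G\subseteq\mathbb P$ such that $p\le q\in G$ implies $p\in G$, and any two members of $G$ have a common upper bound in $G$. For a cardinal $\kappa$, $\mathbf{MA}_\kappa$ is the statement: for every ccc forcing notion $\mathbb Q$, every family $\langle \mathcal A_\alpha:\alpha<\kappa\rangle$ of maximal antichains of $\mathbb Q$ and every $p\in\mathbb Q$, there is a filter $G\subseteq\mathbb Q$ with $p\in G$ and $G\cap\mathcal A_\alpha\ne\emptyset$ for all $\alpha<\kappa$. Finally, $\mathbb P$ adds a Cohen real if there is a $\mathbb P$-name $\dot c$ such that every condition forces that $\dot c\in 2^\omega$ is a Cohen real over the ground model $\mathbf V$, i.e. that $\dot c$ belongs to no closed nowhere dense subset of $2^\omega$ coded in $\mathbf V$. Corollary. Let $\kappa$ be a cardinal and assume $\mathbf{MA}_\kappa$.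 If $\mathbb P$ is a ccc atomless forcing notion of cardinality $\kappa$, then $\mathbb P$ adds a Cohen real. -/

import Mathlib

open scoped Cardinal

universe u

/-! A forcing notion is a preordered set `P`; the greater condition is the stronger one. -/

namespace Forcing

section Orders

/-- Two conditions are compatible if they have a common strengthening. -/
def Compat {P : Type u} [Preorder P] (p q : P) : Prop :=
  ∃ r, p ≤ r ∧ q ≤ r

/-- An antichain (in the sense of forcing): any two distinct members are incompatible. -/
def IsAntichain {P : Type u} [Preorder P] (A : Set P) : Prop :=
  ∀ p ∈ A, ∀ q ∈ A, p ≠ q → ¬ Compat p q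

/-- A maximal antichain: an antichain such that every condition is compatible with a member. -/
def IsMaximalAntichain {P : Type u} [Preorder P] (A : Set P) : Prop :=
  IsAntichain A ∧ ∀ p : P, ∃ a ∈ A, Compat p a

/-- A filter of conditions: nonempty, closed under weakening, and any two members have a common
strengthening in it. -/
structure IsFilter {P : Type u} [Preorder P] (G : Set P) : Prop where
  nonempty : G.Nonempty
  weaker_mem : ∀ p q : P, p ≤ q → q ∈ G → p ∈ G
  directed : ∀ p ∈ G, ∀ q ∈ G, ∃ r ∈ G, p ≤ r ∧ q ≤ r

/-- The countable chain condition. -/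
def CCC (P : Type u) [Preorder P] : Prop :=
  ∀ A : Set P, IsAntichain A → A.Countable

/-- Every condition has two incompatible strengthenings. -/
def Atomless (P : Type u) [Preorder P] : Prop :=
  ∀ p : P, ∃ q r : P, p ≤ q ∧ p ≤ r ∧ ¬ Compat q r

/-- `MA_κ(P)`: for any `κ` maximal antichains of `P` and any `p : P` there is a filter
containing `p` that meets all of them. -/
def MartinFor (κ : Cardinal.{u}) (P : Type u) [Preorder P] : Prop :=
  ∀ (ι : Type u), #ι = κ → ∀ A : ι → Set P, (∀ i, IsMaximalAntichain (A i)) →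
    ∀ p : P, ∃ G : Set P, IsFilter G ∧ p ∈ G ∧ ∀ i, (G ∩ A i).Nonempty

/-- `MA_κ`: the statement `MA_κ(P)` for all ccc forcing notions `P`. -/
def MartinAxiom (κ : Cardinal.{u}) : Prop :=
  ∀ (P : Type u) [Preorder P], CCC P → MartinFor κ P

end Orders

section Language

/-! The forcing relation. A sentence of the forcing language is represented by the set of
conditions that force it; quantifiers range over sets of the ground model. -/

/-- The conditions forcing `¬ φ`: those with no strengthening that forces `φ`. -/
def fNot {P : Type u} [Preorder P] (φ : P → Prop) : P → Prop :=
  fun p => ∀ q, p ≤ q → ¬ φ q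

/-- The conditions forcing `φ ∧ ψ`. -/
def fAnd {P : Type u} (φ ψ : P → Prop) : P → Prop :=
  fun p => φ p ∧ ψ p

/-- The conditions forcing `∀ i, φ i`. -/
def fAll {P : Type u} {ι : Type*} (φ : ι → P → Prop) : P → Prop :=
  fun p => ∀ i, φ i p

/-- The conditions `p` forcing `∃ i, φ i`: the conditions that force some instance are dense
above `p`. -/
def fEx {P : Type u} [Preorder P] {ι : Type*} (φ : ι → P → Prop) : P → Prop :=
  fun p => ∀ q, p ≤ q → ∃ r, q ≤ r ∧ ∃ i, φ i r

/-- A `P`-name for a subset of `ω × 2`: a set of pairs `((n, b), s)`, standing for the name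
`{⟨(n, b)ˇ, s⟩ : ((n, b), s) ∈ c}`. Its value under a generic filter `G` is
`{(n, b) : ((n, b), s) ∈ c for some s ∈ G}`. -/
abbrev RealName (P : Type u) : Type u := Set ((ℕ × Bool) × P)

/-- The conditions `p` forcing `(n, b) ∈ c`: the conditions stronger than some `s` with
`((n, b), s) ∈ c` are dense above `p`. -/
def fMem {P : Type u} [Preorder P] (c : RealName P) (n : ℕ) (b : Bool) : P → Prop :=
  fun p => ∀ q, p ≤ q → ∃ r, q ≤ r ∧ ∃ s, s ≤ r ∧ ((n, b), s) ∈ c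

/-- The sentence "`c` is a function from `ω` to `2`". -/
def fIsReal {P : Type u} [Preorder P] (c : RealName P) : P → Prop :=
  fAnd (fAll fun n : ℕ => fEx fun b : Bool => fMem c n b)
    (fAll fun n : ℕ => fNot (fAnd (fMem c n false) (fMem c n true)))

/-- The sentence "the finite sequence `s` is an initial segment of `c`". -/
def fInitial {P : Type u} [Preorder P] (c : RealName P) (s : List Bool) : P → Prop :=
  fAll fun i : Fin s.length => fMem c i (s.get i)

/-- The basic clopen set `[s]` of the Cantor space. -/
def cylinder (s : List Bool) : Set (ℕ → Bool) :=
  {x | ∀ i : Fin s.length, x i = s.get i}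

/-- The sentence "`c ∉ A`" for a closed set `A` of the ground model. In the extension `A` is
interpreted as the closed set with the same code, i.e. the complement of the union of all `[s]`,
`s` a finite sequence with `[s] ∩ A = ∅` in the ground model. -/
def fNotMemClosed {P : Type u} [Preorder P] (c : RealName P) (A : Set (ℕ → Bool)) : P → Prop :=
  fEx fun s : {s : List Bool // Disjoint (cylinder s) A} => fInitial c s.1

/-- The sentence "`c` is a Cohen real over the ground model": `c` is an element of the Cantor
space which lies in no closed nowhere dense set coded in the ground model. -/
def fIsCohen {P : Type u} [Preorder P] (c : RealName P) : P → Prop :=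
  fAnd (fIsReal c)
    (fAll fun A : {A : Set (ℕ → Bool) // IsClosed A ∧ IsNowhereDense A} => fNotMemClosed c A.1)

/-- `P` adds a Cohen real: there is a `P`-name which every condition forces to be a Cohen real
over the ground model. -/
def AddsCohenReal (P : Type u) [Preorder P] : Prop :=
  ∃ c : RealName P, ∀ p : P, fIsCohen c p

end Language

end Forcing

namespace Forcing

/-! ### Compatibility, maximal antichains, and Martin's axiom for dense sets -/

section Basic

variable {P : Type u} [Preorder P]

/-! Martin's axiom makes `P` Knaster, so its finite-support power is ccc. A filter on that power
yields countably many filters `G k` that cover `P` and decide every condition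
(`MartinAxiom.exists_seq_filter`). By atomlessness each `G k` has a maximal antichain `B k` of which
every member of `G k` meets infinitely many elements. Hence in the tree of choices from `B 0, B 1,
…` every `p` is consistent with an infinitely splitting node (`exists_infinite_splitting`). This
gives only `κ` infinite sets of successors, so Martin's axiom supplies labels in `2^{<ω}` such that
every label occurs among the successors at each of these nodes. The labels along the generic branch
concatenate to a Cohen real: `p` has a node deciding some `t`, and every `w` can be appended to `t`
by extending `p`. -/

theorem Compat.symm {p q : P} (h : Compat p q) : Compat q p :=
  let ⟨r, hp, hq⟩ := h; ⟨r, hq, hp⟩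

theorem Compat.refl (p : P) : Compat p p := ⟨p, le_rfl, le_rfl⟩

theorem Compat.mono {p p' q q' : P} (h : Compat p' q') (hp : p ≤ p') (hq : q ≤ q') : Compat p q :=
  let ⟨r, h1, h2⟩ := h; ⟨r, hp.trans h1, hq.trans h2⟩

/-- Every dense set of conditions includes a maximal antichain. -/
theorem exists_isMaximalAntichain_subset (D : Set P) (hD : ∀ p, ∃ q, p ≤ q ∧ q ∈ D) :
    ∃ A ⊆ D, IsMaximalAntichain A := by
  obtain ⟨A, hA⟩ := zorn_subset {A : Set P | A ⊆ D ∧ IsAntichain A} (by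
    intro c hc hchain
    refine ⟨⋃₀ c, ⟨Set.sUnion_subset fun s hs => (hc hs).1, ?_⟩, fun s hs =>
      Set.subset_sUnion_of_mem hs⟩
    rintro p ⟨s, hs, hps⟩ q ⟨t, ht, hqt⟩ hpq
    rcases hchain.total hs ht with h | h
    · exact (hc ht).2 p (h hps) q hqt hpq
    · exact (hc hs).2 p hps q (h hqt) hpq)
  refine ⟨A, hA.prop.1, hA.prop.2, fun p => ?_⟩
  obtain ⟨q, hpq, hq⟩ := hD p
  by_contra! hno
  have hins : insert q A ⊆ D ∧ IsAntichain (insert q A) := by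
    refine ⟨Set.insert_subset hq hA.prop.1, ?_⟩
    have key : ∀ a ∈ A, ¬ Compat q a := fun a ha h => hno a ha (h.mono hpq le_rfl)
    rintro x (rfl | hx) y (rfl | hy) hxy
    · exact absurd rfl hxy
    · exact key y hy
    · exact fun h => key x hx h.symm
    · exact hA.prop.2 x hx y hy hxy
  have hqA : q ∈ A := hA.le_of_ge hins (Set.subset_insert q A) (Set.mem_insert q A)
  exact hno q hqA ⟨q, hpq, le_rfl⟩

/-- The dense-set form of Martin's axiom. -/
theorem MartinAxiom.exists_filter {κ : Cardinal.{u}} (hMA : MartinAxiom κ) (hccc : CCC P)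
    {ι : Type u} [Nonempty ι] (hι : #ι ≤ κ) (D : ι → Set P)
    (hD : ∀ i p, ∃ q, p ≤ q ∧ q ∈ D i) (p : P) :
    ∃ G : Set P, IsFilter G ∧ p ∈ G ∧ ∀ i, (G ∩ D i).Nonempty := by
  choose A hAD hA using fun i => exists_isMaximalAntichain_subset (D i) (hD i)
  obtain ⟨e⟩ : Nonempty (ι ↪ κ.out) := by rwa [← Cardinal.le_def, Cardinal.mk_out]
  -- `MartinFor` wants exactly `κ` antichains; repetition pads the family.
  obtain ⟨G, hG, hpG, hGA⟩ := hMA P hccc κ.out κ.mk_out (fun k => A (Function.invFun e k))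
    (fun k => hA _) p
  refine ⟨G, hG, hpG, fun i => ?_⟩
  have h := hGA (e i)
  rw [Function.leftInverse_invFun e.injective i] at h
  exact h.mono (Set.inter_subset_inter_right _ (hAD i))

/-- A nonempty atomless forcing notion is infinite. -/
theorem Atomless.infinite [Nonempty P] (h : Atomless P) : Infinite P := by
  by_contra hfin
  rw [not_infinite_iff_finite] at hfin
  obtain ⟨p, hp⟩ := Set.Finite.exists_maximal (Set.toFinite (Set.univ : Set P)) Set.univ_nonempty
  obtain ⟨q, r, hq, hr, hqr⟩ := h p
  exact hqr ⟨p, hp.2 trivial hq, hp.2 trivial hr⟩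

end Basic

/-! ### The Knaster property from Martin's axiom -/

section Knaster

/-- The Knaster property: every uncountable family of conditions has an uncountable subfamily of
pairwise compatible members. -/
def Knaster (P : Type u) [Preorder P] : Prop :=
  ∀ (J : Type u) [Uncountable J] (f : J → P),
    ∃ T : Set J, ¬ T.Countable ∧ ∀ a ∈ T, ∀ b ∈ T, Compat (f a) (f b)

theorem exists_uncountable_fiber {J : Type*} [Uncountable J] {X : Type*} [Countable X]
    (f : J → X) : ∃ x, ¬ (f ⁻¹' {x}).Countable := by
  by_contra! h
  have : (Set.univ : Set J).Countable :=
    (Set.countable_iUnion h).mono fun a _ => Set.mem_iUnion.2 ⟨f a, rfl⟩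
  exact Set.not_countable_univ this

variable {P : Type u} [Preorder P]

theorem Knaster.of_countable [Countable P] : Knaster P := by
  intro J _ f
  obtain ⟨x, hx⟩ := exists_uncountable_fiber f
  refine ⟨_, hx, fun a ha b hb => ?_⟩
  rw [show f a = x from ha, show f b = x from hb]
  exact Compat.refl x

/-- In a ccc forcing notion, some condition is such that all its strengthenings are compatible with
uncountably many members of a given uncountable family. -/
theorem CCC.exists_forall_uncountable (hccc : CCC P) {J : Type*} [Uncountable J] (f : J → P) :
    ∃ p, ∀ q, p ≤ q → ¬ {a | Compat q (f a)}.Countable := by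
  by_contra! h
  obtain ⟨A, hAD, hA⟩ := exists_isMaximalAntichain_subset
    {q : P | {a | Compat q (f a)}.Countable} h
  have hU : (⋃ q ∈ A, {a | Compat q (f a)}).Countable :=
    (hccc A hA.1).biUnion fun q hq => hAD hq
  refine Set.not_countable_univ (hU.mono fun a _ => ?_)
  obtain ⟨q, hq, hc⟩ := hA.2 (f a)
  exact Set.mem_biUnion hq hc.symm

/-- A filter is pairwise compatible, so it suffices that one contains uncountably many members of an
`ω₁`-indexed subfamily. -/
theorem MartinAxiom.knaster {κ : Cardinal.{u}} (hMA : MartinAxiom κ) (hκ : ℵ₁ ≤ κ)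
    (hccc : CCC P) : Knaster P := by
  intro J _ f
  let I : Type u := (ℵ₁ : Cardinal.{u}).ord.ToType
  have hI : #I = ℵ₁ := Cardinal.mk_ord_toType _
  have hIic : ∀ i : I, (Set.Iic i).Countable := fun i => by
    rw [← Set.Iio_union_right]
    refine Set.Countable.union ?_ (Set.countable_singleton i)
    have := Cardinal.mk_Iio_lt i (by rw [hI, Ordinal.type_toType])
    rw [← Cardinal.le_aleph0_iff_set_countable]
    exact Cardinal.lt_aleph_one_iff.1 (this.trans_eq hI)
  have : Uncountable I := by
    rw [← Cardinal.aleph0_lt_mk_iff, hI]; exact Cardinal.aleph0_lt_aleph_one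
  have hIne : Nonempty I := inferInstance
  obtain ⟨e⟩ : Nonempty (I ↪ J) := by
    rw [← Cardinal.le_def, hI]
    exact Cardinal.aleph_one_le_iff.2 (Cardinal.aleph0_lt_mk_iff.2 inferInstance)
  obtain ⟨p, hp⟩ := hccc.exists_forall_uncountable (fun i => f (e i))
  -- Below `i` there are only countably many indices, so the choice of `p` makes these sets dense.
  -- As `p ∈ G`, the first alternative fails in `G`, and the indices caught are cofinal in `ω₁`.
  obtain ⟨G, hG, hpG, hGD⟩ := hMA.exists_filter hccc (hI.trans_le hκ)
    (fun i => {q | ¬ Compat p q ∨ ∃ j, i < j ∧ f (e j) ≤ q}) (by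
      intro i q
      by_cases hc : Compat p q
      · obtain ⟨r, hpr, hqr⟩ := hc
        obtain ⟨j, hj, hij⟩ : ∃ j, Compat r (f (e j)) ∧ i < j := by
          by_contra! hno
          exact hp r hpr ((hIic i).mono fun j hj => hno j hj)
        obtain ⟨s, hrs, hjs⟩ := hj
        exact ⟨s, hqr.trans hrs, Or.inr ⟨j, hij, hjs⟩⟩
      · exact ⟨q, le_rfl, Or.inl hc⟩) p
  refine ⟨e '' {j | f (e j) ∈ G}, fun hcount => ?_, ?_⟩
  · have hS : {j | f (e j) ∈ G}.Countable := Set.countable_of_injective_of_countable_image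
      e.injective.injOn hcount
    have hU : (⋃ j ∈ {j | f (e j) ∈ G}, Set.Iic j).Countable := hS.biUnion fun j _ => hIic j
    refine Set.not_countable_univ (hU.mono fun i _ => ?_)
    obtain ⟨q, hqG, hq⟩ := hGD i
    rcases hq with hq | ⟨j, hij, hjq⟩
    · obtain ⟨r, -, h1, h2⟩ := hG.directed p hpG q hqG
      exact absurd ⟨r, h1, h2⟩ hq
    · exact Set.mem_biUnion (show f (e j) ∈ G from hG.weaker_mem _ _ hjq hqG) hij.le
  · rintro _ ⟨a, ha, rfl⟩ _ ⟨b, hb, rfl⟩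
    obtain ⟨r, -, h1, h2⟩ := hG.directed _ ha _ hb
    exact ⟨r, h1, h2⟩

end Knaster

/-! ### Finite-support powers and sequences of filters -/

section FinSeq

/-- The finite-support power of `X` with `ω` coordinates: a condition is a sequence of which only
the first `len` terms matter. -/
structure FinSeq (X : Type u) : Type u where
  len : ℕ
  val : ℕ → X

instance (X : Type u) [Preorder X] : Preorder (FinSeq X) where
  le s t := s.len ≤ t.len ∧ ∀ i < s.len, s.val i ≤ t.val i
  le_refl s := ⟨le_rfl, fun _ _ => le_rfl⟩
  le_trans s t v hst htv := ⟨hst.1.trans htv.1, fun i hi =>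
    (hst.2 i hi).trans (htv.2 i (hi.trans_le hst.1))⟩

variable {X : Type u} [Preorder X]

theorem FinSeq.compat_of_forall {s t : FinSeq X} (hlen : s.len = t.len)
    (h : ∀ i < s.len, Compat (s.val i) (t.val i)) : Compat s t := by
  have : Nonempty X := ⟨s.val 0⟩
  choose! r hs ht using h
  exact ⟨⟨s.len, r⟩, ⟨le_rfl, hs⟩, ⟨hlen.ge, fun i hi => ht i (hlen ▸ hi)⟩⟩

/-- Fix the length on an uncountable set, then thin it out one coordinate at a time. -/
theorem Knaster.ccc_finSeq (hX : Knaster X) : CCC (FinSeq X) := by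
  intro A hA
  by_contra hcount
  have : Uncountable A := by
    rwa [← not_countable_iff, Set.countable_coe_iff]
  obtain ⟨n, hn⟩ := exists_uncountable_fiber (fun a : A => a.1.len)
  have key : ∀ k : ℕ, ∃ T : Set A, ¬ T.Countable ∧ (∀ a ∈ T, a.1.len = n) ∧
      ∀ a ∈ T, ∀ b ∈ T, ∀ i < k, Compat (a.1.val i) (b.1.val i) := by
    intro k
    induction k with
    | zero => exact ⟨_, hn, fun a ha => ha, by simp⟩
    | succ k ih =>
      obtain ⟨T, hT, hlen, hc⟩ := ih
      have : Uncountable T := by rwa [← not_countable_iff, Set.countable_coe_iff]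
      obtain ⟨S, hS, hSc⟩ := hX T (fun a => a.1.1.val k)
      refine ⟨Subtype.val '' S, fun h => hS (Set.countable_of_injective_of_countable_image
        Subtype.val_injective.injOn h), ?_, ?_⟩
      · rintro _ ⟨a, -, rfl⟩
        exact hlen a a.2
      · rintro _ ⟨a, ha, rfl⟩ _ ⟨b, hb, rfl⟩ i hi
        rcases Nat.lt_succ_iff_lt_or_eq.1 hi with hi | rfl
        · exact hc a a.2 b b.2 i hi
        · exact hSc a ha b hb
  obtain ⟨T, hT, hlen, hc⟩ := key n
  obtain ⟨a, ha, b, hb, hab⟩ : T.Nontrivial := by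
    by_contra h
    exact hT (Set.not_nontrivial_iff.1 h).countable
  refine hA a a.2 b b.2 (fun h => hab (Subtype.ext h))
    (FinSeq.compat_of_forall ((hlen a ha).trans (hlen b hb).symm) fun i hi => hc a ha b hb i ?_)
  rwa [hlen a ha] at hi

/-- Martin's axiom for the finite-support power yields a sequence of filters which decide every
condition, and such that every condition is met along each of the given infinite sets. -/
theorem MartinAxiom.exists_seq_filter {κ : Cardinal.{u}} (hMA : MartinAxiom κ) (hκ : ℵ₀ ≤ κ)
    (hX : Knaster X) [Nonempty X] (hXκ : #X ≤ κ) {J : Type u} (hJ : #J ≤ κ)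
    (Z : J → Set ℕ) (hZ : ∀ j, (Z j).Infinite) :
    ∃ G : ℕ → Set X, (∀ k, IsFilter (G k)) ∧ (∀ k x, x ∈ G k ∨ ∃ y ∈ G k, ¬ Compat x y) ∧
      ∀ j x, ∃ k ∈ Z j, x ∈ G k := by
  classical
  obtain ⟨x₀⟩ := ‹Nonempty X›
  -- The left sets put `x` into some `G k` with `k ∈ Z j`; the right ones make `G k` decide `x`.
  let D : (J × X) ⊕ (ℕ × X) → Set (FinSeq X) := Sum.elim
    (fun a => {s | ∃ k ∈ Z a.1, k < s.len ∧ a.2 ≤ s.val k})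
    (fun a => {s | a.1 < s.len ∧ (a.2 ≤ s.val a.1 ∨ ¬ Compat a.2 (s.val a.1))})
  have hι : #((J × X) ⊕ (ℕ × X)) ≤ κ := by
    rw [Cardinal.mk_sum, Cardinal.lift_id, Cardinal.lift_id, Cardinal.mk_prod, Cardinal.mk_prod]
    simp only [Cardinal.lift_id, Cardinal.lift_uzero, Cardinal.mk_nat, Cardinal.lift_aleph0]
    exact Cardinal.add_le_of_le hκ (Cardinal.mul_le_of_le hκ hJ hXκ)
      (Cardinal.mul_le_of_le hκ hκ hXκ)
  have : Nonempty ((J × X) ⊕ (ℕ × X)) := ⟨Sum.inr (0, x₀)⟩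
  obtain ⟨G, hG, -, hGD⟩ := hMA.exists_filter hX.ccc_finSeq hι D (by
    rintro (⟨j, x⟩ | ⟨i, x⟩) s
    · obtain ⟨k, hk, hlt⟩ := (hZ j).exists_gt s.len
      refine ⟨⟨k + 1, Function.update s.val k x⟩, ⟨by simp; omega, fun i hi => ?_⟩,
        k, hk, Nat.lt_succ_self k, by simp⟩
      exact (Function.update_of_ne (show i ≠ k by omega) x s.val).ge
    · by_cases hc : Compat x (s.val i)
      · obtain ⟨r, hxr, hsr⟩ := hc
        refine ⟨⟨max s.len (i + 1), Function.update s.val i r⟩, ⟨le_max_left _ _, fun l hl => ?_⟩,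
          ?_, Or.inl (by simpa using hxr)⟩
        · rcases eq_or_ne l i with rfl | hne
          · simpa using hsr
          · exact (Function.update_of_ne hne r s.val).ge
        · simp
      · exact ⟨⟨max s.len (i + 1), s.val⟩, ⟨le_max_left _ _, fun _ _ => le_rfl⟩, by simp,
          Or.inr hc⟩) ⟨0, fun _ => x₀⟩
  refine ⟨fun k => {x | ∃ s ∈ G, k < s.len ∧ x ≤ s.val k}, fun k => ⟨?_, ?_, ?_⟩, ?_, ?_⟩
  · obtain ⟨s, hs, hk, -⟩ := hGD (Sum.inr (k, x₀))
    exact ⟨s.val k, s, hs, hk, le_rfl⟩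
  · rintro p q hpq ⟨s, hs, hk, hq⟩
    exact ⟨s, hs, hk, hpq.trans hq⟩
  · rintro p ⟨s, hs, hks, hp⟩ q ⟨t, ht, hkt, hq⟩
    obtain ⟨v, hv, hsv, htv⟩ := hG.directed s hs t ht
    exact ⟨v.val k, ⟨v, hv, hks.trans_le hsv.1, le_rfl⟩, hp.trans (hsv.2 k hks),
      hq.trans (htv.2 k hkt)⟩
  · intro k x
    obtain ⟨s, hs, hk, h⟩ := hGD (Sum.inr (k, x))
    exact h.imp (fun h => ⟨s, hs, hk, h⟩) fun h => ⟨_, ⟨s, hs, hk, le_rfl⟩, h⟩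
  · intro j x
    obtain ⟨s, hs, k, hkZ, hk, h⟩ := hGD (Sum.inl (j, x))
    exact ⟨k, hkZ, s, hs, hk, h⟩

/-- Under Martin's axiom, for any `κ` infinite sets of natural numbers some function maps each of
them onto a given countable set. -/
theorem MartinAxiom.exists_surjOn {κ : Cardinal.{u}} (hMA : MartinAxiom κ) (hκ : ℵ₀ ≤ κ)
    {W : Type} [Countable W] [Nonempty W] {J : Type u} (hJ : #J ≤ κ) (Z : J → Set ℕ)
    (hZ : ∀ j, (Z j).Infinite) : ∃ F : ℕ → W, ∀ j w, ∃ k ∈ Z j, F k = w := by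
  -- Under equality as order a filter is a singleton, so each `G k` is one value `F k`.
  let _ : Preorder (ULift.{u} W) :=
    { le := fun a b => a = b, le_refl := fun _ => rfl, le_trans := fun _ _ _ => Eq.trans }
  obtain ⟨G, hG, -, hGZ⟩ := hMA.exists_seq_filter hκ (X := ULift.{u} W) Knaster.of_countable
    ((Cardinal.mk_le_aleph0).trans hκ) hJ Z hZ
  choose F hF using fun k => (hG k).nonempty
  refine ⟨fun k => (F k).down, fun j w => ?_⟩
  obtain ⟨k, hk, hw⟩ := hGZ j ⟨w⟩
  obtain ⟨r, -, h1, h2⟩ := (hG k).directed _ (hF k) _ hw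
  exact ⟨k, hk, congrArg ULift.down ((show F k = r from h1).trans (show ⟨w⟩ = r from h2).symm)⟩

end FinSeq

/-! ### Infinitely splitting nodes in a tree of antichains -/

section Splitting

variable {P : Type u} [Preorder P]

/-- If a filter decides every condition of an atomless forcing notion, then some maximal antichain
has infinitely many members compatible with each condition in the filter. -/
theorem IsFilter.exists_isMaximalAntichain {G : Set P} (hG : IsFilter G) (hP : Atomless P)
    (hdec : ∀ p, p ∈ G ∨ ∃ q ∈ G, ¬ Compat p q) :
    ∃ B : Set P, IsMaximalAntichain B ∧ ∀ p ∈ G, {b ∈ B | Compat p b}.Infinite := by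
  obtain ⟨B, hBD, hB⟩ := exists_isMaximalAntichain_subset {q : P | ∃ r ∈ G, ¬ Compat q r} (by
    intro p
    obtain ⟨q, r, hq, hr, hqr⟩ := hP p
    rcases hdec q with hqG | h
    · rcases hdec r with hrG | h
      · obtain ⟨s, -, h1, h2⟩ := hG.directed q hqG r hrG
        exact absurd ⟨s, h1, h2⟩ hqr
      · exact ⟨r, hr, h⟩
    · exact ⟨q, hq, h⟩)
  refine ⟨B, hB, fun p hp hfin => ?_⟩
  -- Finitely many elements of `B` are all refuted by one `r ∈ G` above `p`; maximality of `B` then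
  -- gives another element compatible with `r`.
  have key : ∀ S : Set P, S.Finite → S ⊆ B → ∃ r ∈ G, p ≤ r ∧ ∀ b ∈ S, ¬ Compat b r := by
    intro S hS
    induction S, hS using Set.Finite.induction_on with
    | empty => exact fun _ => ⟨p, hp, le_rfl, by simp⟩
    | @insert b S _ _ ih =>
      intro hSB
      obtain ⟨r, hr, hpr, hrS⟩ := ih ((Set.subset_insert b S).trans hSB)
      obtain ⟨t, ht, hbt⟩ := hBD (hSB (Set.mem_insert b S))
      obtain ⟨v, hv, hrv, htv⟩ := hG.directed r hr t ht
      refine ⟨v, hv, hpr.trans hrv, ?_⟩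
      rintro a (rfl | ha) h
      · exact hbt (h.mono le_rfl htv)
      · exact hrS a ha (h.mono le_rfl hrv)
  obtain ⟨r, -, hpr, hr⟩ := key _ hfin fun b hb => hb.1
  obtain ⟨b, hb, hrb⟩ := hB.2 r
  exact hr b ⟨hb, hrb.mono hpr le_rfl⟩ hrb.symm

theorem exists_le_forall_mem {B : ℕ → Set P} (hB : ∀ n, IsMaximalAntichain (B n)) (n : ℕ)
    (p : P) : ∃ r, p ≤ r ∧ ∃ σ : ℕ → P, ∀ i < n, σ i ∈ B i ∧ σ i ≤ r := by
  classical
  induction n with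
  | zero => exact ⟨p, le_rfl, fun _ => p, by simp⟩
  | succ n ih =>
    obtain ⟨r, hpr, σ, hσ⟩ := ih
    obtain ⟨b, hb, s, hrs, hbs⟩ := (hB n).2 r
    refine ⟨s, hpr.trans hrs, Function.update σ n b, fun i hi => ?_⟩
    rcases Nat.lt_succ_iff_lt_or_eq.1 hi with hi | rfl
    · rw [Function.update_of_ne hi.ne]
      exact ⟨(hσ i hi).1, (hσ i hi).2.trans hrs⟩
    · simpa using ⟨hb, hbs⟩

/-- The tree of a sequence of maximal antichains has, below each condition `p`, an infinitely
splitting node, provided that `p` is compatible with infinitely many members of an antichain. -/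
theorem exists_infinite_splitting {B : ℕ → Set P} (hB : ∀ n, IsMaximalAntichain (B n)) {p : P}
    (hp : ∃ n, {b ∈ B n | Compat p b}.Infinite) :
    ∃ (n : ℕ) (σ : ℕ → P),
      {b ∈ B n | ∃ r, p ≤ r ∧ b ≤ r ∧ ∀ i < n, σ i ∈ B i ∧ σ i ≤ r}.Infinite := by
  classical
  have hmin : ∀ i < Nat.find hp, {b ∈ B i | Compat p b}.Finite := fun i hi =>
    Set.not_infinite.1 (Nat.find_min hp hi)
  have hinf := Nat.find_spec hp
  set n := Nat.find hp
  have h : ∀ b ∈ {b ∈ B n | Compat p b}, ∃ σ : ℕ → P, ∃ r, p ≤ r ∧ b ≤ r ∧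
      ∀ i < n, σ i ∈ B i ∧ σ i ≤ r := by
    rintro b ⟨-, r, hpr, hbr⟩
    obtain ⟨s, hrs, σ, hσ⟩ := exists_le_forall_mem hB n r
    exact ⟨σ, s, hpr.trans hrs, hbr.trans hrs, hσ⟩
  choose! τ hτ using h
  have hfin : (Set.pi Set.univ fun i : Fin n => {b ∈ B i | Compat p b}).Finite :=
    Set.Finite.pi fun i => hmin i i.2
  have hmaps : Set.MapsTo (fun b (i : Fin n) => τ b i) {b ∈ B n | Compat p b}
      (Set.pi Set.univ fun i : Fin n => {b ∈ B i | Compat p b}) := by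
    intro b hb i _
    obtain ⟨r, hpr, -, hr⟩ := hτ b hb
    exact ⟨(hr i i.2).1, r, hpr, (hr i i.2).2⟩
  -- Pigeonhole: by minimality of `n` only finitely many nodes of height `n` are consistent with
  -- `p`, so infinitely many `b` share one.
  obtain ⟨b₀, hb₀, hinf'⟩ : ∃ b₀ ∈ {b ∈ B n | Compat p b},
      {b ∈ {b ∈ B n | Compat p b} | ∀ i < n, τ b i = τ b₀ i}.Infinite := by
    by_contra! hno
    refine hinf (Set.Finite.subset (Set.Finite.biUnion
      (hfin.subset hmaps.image_subset)
      (t := fun v => {b ∈ {b ∈ B n | Compat p b} | (fun i : Fin n => τ b i) = v}) ?_) ?_)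
    · rintro _ ⟨b, hb, rfl⟩
      refine (hno b hb).subset fun a ha => ⟨ha.1, fun i hi => ?_⟩
      exact congrFun ha.2 ⟨i, hi⟩
    · exact fun b hb => Set.mem_biUnion ⟨b, hb, rfl⟩ ⟨hb, rfl⟩
  refine ⟨n, τ b₀, hinf'.mono ?_⟩
  rintro b ⟨hb, heq⟩
  obtain ⟨r, hpr, hbr, hr⟩ := hτ b hb
  exact ⟨hb.1, r, hpr, hbr, fun i hi => heq i hi ▸ hr i hi⟩

end Splitting

/-! ### The name of the concatenated real -/

section Name

variable {P : Type u} [Preorder P]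

/-- The condition `r` decides `L` to be the concatenation of the values of `h` along the members of
the first few antichains in the generic filter. -/
def Decides (B : ℕ → Set P) (h : ℕ → P → List Bool) (r : P) (L : List Bool) : Prop :=
  ∃ (n : ℕ) (σ : ℕ → P), (∀ i < n, σ i ∈ B i ∧ σ i ≤ r) ∧
    L = (List.range n).flatMap fun i => h i (σ i)

variable {B : ℕ → Set P} {h : ℕ → P → List Bool}

theorem Decides.mono {r s : P} {L : List Bool} (hr : Decides B h r L) (hrs : r ≤ s) :
    Decides B h s L := by
  obtain ⟨n, σ, hσ, rfl⟩ := hr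
  exact ⟨n, σ, fun i hi => ⟨(hσ i hi).1, (hσ i hi).2.trans hrs⟩, rfl⟩

theorem flatMap_range_prefix (f : ℕ → List Bool) {m n : ℕ} (hmn : m ≤ n) :
    (List.range m).flatMap f <+: (List.range n).flatMap f := by
  obtain ⟨k, rfl⟩ := Nat.exists_eq_add_of_le hmn
  rw [List.range_add, List.flatMap_append]
  exact List.prefix_append _ _

theorem Decides.prefix_or_prefix (hB : ∀ n, IsAntichain (B n)) {r : P} {L L' : List Bool}
    (hL : Decides B h r L) (hL' : Decides B h r L') : L <+: L' ∨ L' <+: L := by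
  have key : ∀ {m n : ℕ} {σ τ : ℕ → P}, m ≤ n → (∀ i < m, σ i ∈ B i ∧ σ i ≤ r) →
      (∀ i < n, τ i ∈ B i ∧ τ i ≤ r) → ((List.range m).flatMap fun i => h i (σ i)) <+:
        (List.range n).flatMap fun i => h i (τ i) := by
    intro m n σ τ hmn hσ hτ
    have : ((List.range m).flatMap fun i => h i (σ i)) =
        (List.range m).flatMap fun i => h i (τ i) := by
      refine List.flatMap_congr fun i hi => ?_
      have hi := List.mem_range.1 hi
      have hi' := hi.trans_le hmn
      congr 1
      by_contra hne
      exact hB i _ (hσ i hi).1 _ (hτ i hi').1 hne ⟨r, (hσ i hi).2, (hτ i hi').2⟩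
    rw [this]
    exact flatMap_range_prefix _ hmn
  obtain ⟨m, σ, hσ, rfl⟩ := hL
  obtain ⟨n, τ, hτ, rfl⟩ := hL'
  rcases le_total m n with hmn | hmn
  · exact Or.inl (key hmn hσ hτ)
  · exact Or.inr (key hmn hτ hσ)

/-- The name of the concatenation of the values of `h` along the generic filter. -/
def concatName (B : ℕ → Set P) (h : ℕ → P → List Bool) : RealName P :=
  {x | ∃ L, Decides B h x.2 L ∧ L[x.1.1]? = some x.1.2}

theorem fMem_concatName {r : P} {L : List Bool} (hL : Decides B h r L) {m : ℕ} {b : Bool}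
    (hb : L[m]? = some b) : fMem (concatName B h) m b r :=
  fun q hq => ⟨q, le_rfl, q, le_rfl, L, hL.mono hq, hb⟩

theorem exists_decides_of_fMem {r : P} {m : ℕ} {b : Bool} (hr : fMem (concatName B h) m b r) :
    ∃ s, r ≤ s ∧ ∃ L, Decides B h s L ∧ L[m]? = some b := by
  obtain ⟨s, hrs, t, hts, L, hL, hb⟩ := hr r le_rfl
  exact ⟨s, hrs, L, hL.mono hts, hb⟩

/-- Each basic clopen set has a basic clopen subset disjoint from a given closed nowhere dense
set. -/
theorem exists_disjoint_cylinder {A : Set (ℕ → Bool)} (hA : IsClosed A) (hA' : IsNowhereDense A)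
    (t : List Bool) : ∃ w, Disjoint (cylinder (t ++ w)) A := by
  have hopen : IsOpen (cylinder t) := by
    have : cylinder t = ⋂ i : Fin t.length, {x : ℕ → Bool | x i = t.get i} := by
      ext x; simp [cylinder]
    rw [this]
    exact isOpen_iInter_of_finite fun i =>
      (isOpen_discrete {t.get i}).preimage (continuous_apply (A := fun _ => Bool) (i : ℕ))
  obtain ⟨x, hxt, hxA⟩ : ∃ x ∈ cylinder t, x ∉ A := by
    by_contra! hsub
    have hint : cylinder t ⊆ interior (closure A) :=
      interior_maximal (fun x hx => subset_closure (hsub x hx)) hopen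
    rw [show interior (closure A) = ∅ from hA'] at hint
    exact hint (a := fun i => t.getD i false) fun i => by simp
  obtain ⟨I, u, hu, hsub⟩ := isOpen_pi_iff.1 hA.isOpen_compl x hxA
  obtain ⟨N, hN⟩ := I.bddAbove
  have ht : t = (List.range t.length).map x := by
    refine List.ext_getElem (by simp) fun i hi _ => ?_
    simpa using (hxt ⟨i, hi⟩).symm
  -- The length exceeds `N`, so the cylinder fixes every coordinate in `I`.
  obtain ⟨w, hw⟩ : t <+: (List.range (t.length + (N + 1))).map x := by
    rw [List.range_add, List.map_append, ← ht]
    exact List.prefix_append _ _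
  refine ⟨w, Set.disjoint_left.2 fun y hy => hsub fun i hi => ?_⟩
  rw [hw] at hy
  have hiN : i < ((List.range (t.length + (N + 1))).map x).length := by
    have := hN hi
    simp; omega
  have := hy ⟨i, hiN⟩
  simp at this
  rw [this]
  exact (hu i hi).2

/-- Long `w` make the real total, coherence of decided strings makes it single-valued, and a `w`
leaving `A` makes it avoid `A`. -/
theorem addsCohenReal_of_decides (hB : ∀ n, IsAntichain (B n))
    (hd : ∀ p, ∃ t, ∀ w, ∃ r, p ≤ r ∧ Decides B h r (t ++ w)) : AddsCohenReal P := by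
  refine ⟨concatName B h, fun p => ⟨⟨fun m q _ => ?_, fun m q _ hq => ?_⟩, fun A q _ => ?_⟩⟩
  · obtain ⟨t, ht⟩ := hd q
    obtain ⟨r, hqr, hr⟩ := ht (List.replicate (m + 1) false)
    exact ⟨r, hqr, _, fMem_concatName hr (List.getElem?_eq_getElem (by simp; omega))⟩
  · obtain ⟨r, hqr, L, hL, hf⟩ := exists_decides_of_fMem hq.1
    obtain ⟨s, hrs, L', hL', ht⟩ := exists_decides_of_fMem
      (fun v hv => hq.2 v (hqr.trans hv) : fMem (concatName B h) m true r)
    rcases (hL.mono hrs).prefix_or_prefix hB hL' with hp | hp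
    · obtain ⟨l, rfl⟩ := hp
      rw [List.getElem?_append_left (List.getElem?_eq_some_iff.1 hf).1, hf] at ht
      simp at ht
    · obtain ⟨l, rfl⟩ := hp
      rw [List.getElem?_append_left (List.getElem?_eq_some_iff.1 ht).1, ht] at hf
      simp at hf
  · obtain ⟨t, ht⟩ := hd q
    obtain ⟨w, hw⟩ := exists_disjoint_cylinder A.2.1 A.2.2 t
    obtain ⟨r, hqr, hr⟩ := ht w
    exact ⟨r, hqr, ⟨t ++ w, hw⟩, fun i => fMem_concatName hr (by simp)⟩

end Name

end Forcing

/-! ### Assembly of the Cohen real -/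

open Forcing in
theorem mainTheorem11 (κ : Cardinal.{u}) (hMA : Forcing.MartinAxiom κ)
    (P : Type u) [Preorder P] (hccc : Forcing.CCC P) (hatomless : Forcing.Atomless P)
    (hcard : #P = κ) : Forcing.AddsCohenReal P := by
  classical
  rcases isEmpty_or_nonempty P with hP | hP
  · exact ⟨∅, fun p => hP.elim p⟩
  have hκ : ℵ₀ ≤ κ := hcard ▸ Cardinal.infinite_iff.1 hatomless.infinite
  have hK : Knaster P := by
    rcases hκ.eq_or_lt with h | h
    · have : Countable P := Cardinal.mk_le_aleph0_iff.1 (hcard.trans h.symm).le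
      exact Knaster.of_countable
    · exact hMA.knaster (Cardinal.aleph_one_le_iff.2 h) hccc
  obtain ⟨G, hG, hdec, hcov⟩ := hMA.exists_seq_filter hκ hK hcard.le hcard.le
    (fun _ : P => Set.univ) fun _ => Set.infinite_univ
  choose B hB hBG using fun n => (hG n).exists_isMaximalAntichain hatomless (hdec n)
  have hinf : ∀ p : P, ∃ n, {b ∈ B n | Compat p b}.Infinite := fun p => by
    obtain ⟨n, -, hn⟩ := hcov p p
    exact ⟨n, hBG n p hn⟩
  choose n σ hσ using fun p => exists_infinite_splitting hB (hinf p)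
  choose e he using fun n => Set.countable_iff_exists_injOn.1 (hccc (B n) (hB n).1)
  obtain ⟨F, hF⟩ := hMA.exists_surjOn hκ (W := List Bool) hcard.le _
    fun p => (hσ p).image ((he (n p)).mono fun b hb => hb.1)
  refine addsCohenReal_of_decides (B := B) (h := fun i b => F (e i b)) (fun i => (hB i).1)
    fun p => ⟨(List.range (n p)).flatMap fun i => F (e i (σ p i)), fun w => ?_⟩
  -- `b` is a successor of the node `σ p` labelled `w`; appending it turns the decided string `t`
  -- into `t ++ w`.
  obtain ⟨_, ⟨b, ⟨hb, r, hpr, hbr, hr⟩, rfl⟩, hw⟩ := hF p w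
  refine ⟨r, hpr, n p + 1, Function.update (σ p) (n p) b, fun i hi => ?_, ?_⟩
  · rcases Nat.lt_succ_iff_lt_or_eq.1 hi with hi | rfl
    · rw [Function.update_of_ne hi.ne]
      exact hr i hi
    · simpa using ⟨hb, hbr⟩
  · rw [List.range_succ, List.flatMap_append]
    congr 1
    · refine List.flatMap_congr fun i hi => ?_
      rw [Function.update_of_ne (List.mem_range.1 hi).ne]
    · simp [hw]
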